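/- Conventions. $\mathcal F$ is the set of non-empty finite subsets of $\mathbb N$; for $\alpha,\beta\in\mathcal F$, $\alpha<\beta$ means $\max\alpha<\min\beta$. $\mathbb N^{(m)}$ is the family of $m$-element subsets of $\mathbb N$. Let $G$ be a countable (discrete) abelian group. A sequence $(g_k)_{k\in\mathbb N}$ in $G$ tends to infinity, $\lim_{k\to\infty}g_k=\infty$, if it leaves every finite subset of $G$ eventually. For a sequence $(g_k)_{k\in\mathbb N}$ in $G$ and $\alpha\in\mathcal F$ put $g_\alpha=\sum_{k\in\alpha}g_k$. For $(x_\alpha)_{\alpha\in\mathcal F}$ in $G$ we write $\lim_{\alpha\to\infty}x_\alpha=\infty$ if for every finite $K\subseteq G$ there is $\alpha_0\in\mathcal F$ with $x_\alpha\notin K$ for all $\alpha\in\mathcal F$, $\alpha>\alpha_0$. For a sequence $(\mathbf g_k)_{k\in\mathbb N}=(g_{k,1},\dots,g_{k,m})_{k\in\mathbb N}$ in $G^m$ and $\alpha=\{k_1<\dots<k_m\}\in\mathbb N^{(m)}$ put $g_\alpha=g_{k_1,1}+\dots+g_{k_m,m}$. A sequence $(\mathbf g_k)$ in $G^m$ is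 *non-degenerated* if $\lim_{k\to\infty}g_{k,t}=\infty$ for every $t\in\{1,\dots,m\}$; two sequences $(\mathbf g_k),(\mathbf h_k)$ in $G^m$ are *essentially distinct* if $\lim_{k\to\infty}(g_{k,t}-h_{k,t})=\infty$ for every $t$ (for several sequences: pairwise). A set $E\subseteq G^\ell$ is an $\widetilde{\mathrm{IP}}$ set if $E=\{(g^{(1)}_\alpha,\dots,g^{(\ell)}_\alpha)\,|\,\alpha\in\mathcal F\}$ for some sequences $(g^{(j)}_k)_{k\in\mathbb N}$ in $G$, $j\in\{1,\dots,\ell\}$, with $$\lim_{\alpha\to\infty}g^{(j)}_\alpha=\infty\ \text{ for all } j,\qquad \lim_{\alpha\to\infty}(g^{(j)}_\alpha-g^{(i)}_\alpha)=\infty\ \text{ for all } i\ne j;\qquad(\ast)$$ it is an $\widetilde{\mathrm{IP}}{}^*$ set if it meets every $\widetilde{\mathrm{IP}}$ set in $G^\ell$. An *IP-ring* is a set $\mathcal F^{(1)}=\{\bigcup_{j\in\alpha}\alpha_j\,|\,\alpha\in\mathcal F\}$, where $\alpha_k\in\mathcal F$ and $\alpha_k<\alpha_{k+1}$ for all $k\in\mathbb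 N$. For $x_\alpha,x$ in a metric space $(Y,d)$: $\mathop{\mathrm{IP\text{-}lim}}_{\alpha\in\mathcal F^{(1)}}x_\alpha=x$ means that for every $\epsilon>0$ there is $\alpha_0\in\mathcal F^{(1)}$ with $d(x_\alpha,x)<\epsilon$ for all $\alpha\in\mathcal F^{(1)}$, $\alpha>\alpha_0$; and $\mathop{\mathcal R\text{-}\lim}_{\alpha\in\mathbb N^{(m)}}x_\alpha=x$ means that for every $\epsilon>0$ there is $\alpha_0\in\mathbb N^{(m)}$ with $d(x_\alpha,x)<\epsilon$ for all $\alpha\in\mathbb N^{(m)}$ with $\min\alpha>\max\alpha_0$. Let $(T_g)_{g\in G}$ be a measure preserving action of $G$ on a separable probability space $(X,\mathcal A,\mu)$. A sequence $(S_k)_{k\in\mathbb N}$ of measure preserving transformations of $X$ has the *mixing property* if $\lim_{k\to\infty}\mu(A_0\cap S_k^{-1}A_1)=\mu(A_0)\mu(A_1)$ for all $A_0,A_1\in\mathcal A$. The action is *mildly mixing* if for any sequence $(g_k)_{k\in\mathbb N}$ in $G$ with $\lim_{\alpha\to\infty}g_\alpha=\infty$ there is an IP-ring $\mathcal F^{(1)}$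 such that for every $f\in L^2(\mu)$, $\mathop{\mathrm{IP\text{-}lim}}_{\alpha\in\mathcal F^{(1)}}f\circ T_{g_\alpha}=\int_Xf\,d\mu$ weakly in $L^2(\mu)$. **Theorem.** Let $\ell\in\mathbb N=\{1,2,\dots\}$, let $G$ be a countable abelian group and let $(T_g)_{g\in G}$ be a measure preserving action of $G$ on a separable probability space $(X,\mathcal A,\mu)$. The following statements are equivalent: (i) $(T_g)_{g\in G}$ is mildly mixing. (ii) For any $\widetilde{\mathrm{IP}}$ set $E\subseteq G^\ell$ and any $m\in\mathbb N$ there exist non-degenerated and (pairwise) essentially distinct sequences $(\mathbf g^{(j)}_k)_{k\in\mathbb N}=(g^{(j)}_{k,1},\dots,g^{(j)}_{k,m})_{k\in\mathbb N}$, $j\in\{1,\dots,\ell\}$, in $G^m$ such that: (a) $\{(g^{(1)}_\alpha,\dots,g^{(\ell)}_\alpha)\,|\,\alpha\in\mathbb N^{(m)}\}\subseteq E$; (b) for any $t\in\{1,\dots,m\}$ and any $j\in\{1,\dots,\ell\}$, $(T_{g^{(j)}_{k,t}})_{k\in\mathbb N}$ has the mixing property; (c) for any $t\in\{1,\dots,m\}$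 and any $i\ne j$ in $\{1,\dots,\ell\}$, $(T_{g^{(j)}_{k,t}-g^{(i)}_{k,t}})_{k\in\mathbb N}$ has the mixing property. (iii) For any $\widetilde{\mathrm{IP}}$ set $E\subseteq G^\ell$ there exist $m\in\mathbb N$ and non-degenerated and (pairwise) essentially distinct sequences $(\mathbf g^{(1)}_k)_{k\in\mathbb N},\dots,(\mathbf g^{(\ell)}_k)_{k\in\mathbb N}$ in $G^m$ with $\{(g^{(1)}_\alpha,\dots,g^{(\ell)}_\alpha)\,|\,\alpha\in\mathbb N^{(m)}\}\subseteq E$ such that for all $A_0,\dots,A_\ell\in\mathcal A$, $$\mathop{\mathcal R\text{-}\lim}_{\alpha\in\mathbb N^{(m)}}\mu(A_0\cap T_{g^{(1)}_\alpha}A_1\cap\dots\cap T_{g^{(\ell)}_\alpha}A_\ell)=\prod_{j=0}^\ell\mu(A_j).$$ (iv) For any sequences $(g^{(1)}_k)_{k\in\mathbb N},\dots,(g^{(\ell)}_k)_{k\in\mathbb N}$ in $G$ satisfying $(\ast)$ there exists an IP-ring $\mathcal F^{(1)}$ such that for all $A_0,\dots,A_\ell\in\mathcal A$, $$\mathop{\mathrm{IP\text{-}lim}}_{\alpha\in\mathcal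 F^{(1)}}\mu(A_0\cap T_{g^{(1)}_\alpha}A_1\cap\dots\cap T_{g^{(\ell)}_\alpha}A_\ell)=\prod_{j=0}^\ell\mu(A_j).$$ (v) For all $A_0,\dots,A_\ell\in\mathcal A$ and all $\epsilon>0$, the set $$R_\epsilon(A_0,\dots,A_\ell)=\Big\{(g_1,\dots,g_\ell)\in G^\ell\ \Big|\ \Big|\mu(A_0\cap T_{g_1}A_1\cap\dots\cap T_{g_\ell}A_\ell)-\prod_{j=0}^\ell\mu(A_j)\Big|<\epsilon\Big\}$$ is an $\widetilde{\mathrm{IP}}{}^*$ set. -/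

import Mathlib

open MeasureTheory Filter Topology
open scoped Pointwise

namespace MildMixing

/-- For non-empty finite `α β ⊆ ℕ`, the relation `α < β`, i.e. `max α < min β`. -/
def Before (α β : Finset ℕ) : Prop := ∀ a ∈ α, ∀ b ∈ β, a < b

/-! ### `𝓕`-sequences, IP-rings and IP-limits

`𝓕` is the set of all non-empty finite subsets of `ℕ`; an `𝓕`-sequence is represented by a function
on `Finset ℕ`, of which only the values at non-empty sets are ever used. -/

section IP

variable {G : Type*} [AddCommGroup G]

/-- `g_α = ∑_{k ∈ α} g_k`. -/
def ipSum (g : ℕ → G) (α : Finset ℕ) : G := ∑ k ∈ α, g k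

/-- `lim_{α → ∞} x_α = ∞` for an `𝓕`-sequence: for every finite `K` there is `α₀ ∈ 𝓕` such that
`x_α ∉ K` for every `α ∈ 𝓕` with `α > α₀`. -/
def IPTendstoInfty (x : Finset ℕ → G) : Prop :=
  ∀ K : Finset G, ∃ α₀ : Finset ℕ, α₀.Nonempty ∧
    ∀ α : Finset ℕ, α.Nonempty → Before α₀ α → x α ∉ K

/-- The sequences `g^{(1)}, …, g^{(d)}` in `G` satisfy `lim_{α → ∞} g^{(j)}_α = ∞` for every `j`
and `lim_{α → ∞} (g^{(j)}_α - g^{(i)}_α) = ∞` for all `i ≠ j`. -/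
def IsIPTildeGenerator {d : ℕ} (g : Fin d → ℕ → G) : Prop :=
  (∀ j, IPTendstoInfty (ipSum (g j))) ∧
    ∀ i j, i ≠ j → IPTendstoInfty (fun α => ipSum (g j) α - ipSum (g i) α)

/-- `E ⊆ G^d` is an `ĨP` set. -/
def IsIPTilde {d : ℕ} (E : Set (Fin d → G)) : Prop :=
  ∃ g : Fin d → ℕ → G, IsIPTildeGenerator g ∧
    E = {v | ∃ α : Finset ℕ, α.Nonempty ∧ v = fun j => ipSum (g j) α}

/-- `E ⊆ G^d` is an `ĨP^*` set: it meets every `ĨP` set in `G^d`. -/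
def IsIPTildeStar {d : ℕ} (E : Set (Fin d → G)) : Prop :=
  ∀ D : Set (Fin d → G), IsIPTilde D → (E ∩ D).Nonempty

end IP

/-- An IP-ring: the family of all `⋃_{j ∈ α} α_j`, `α ∈ 𝓕`, for some sequence
`α_0 < α_1 < ⋯` in `𝓕`. -/
def IsIPRing (R : Set (Finset ℕ)) : Prop :=
  ∃ a : ℕ → Finset ℕ, (∀ k, (a k).Nonempty) ∧ (∀ k, Before (a k) (a (k + 1))) ∧
    R = {β | ∃ α : Finset ℕ, α.Nonempty ∧ β = α.biUnion a}

/-- `IP-lim_{α ∈ R} x_α = y`. -/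
def IPLim {Y : Type*} [PseudoMetricSpace Y] (R : Set (Finset ℕ)) (x : Finset ℕ → Y) (y : Y) :
    Prop :=
  ∀ ε > 0, ∃ α₀ ∈ R, ∀ α ∈ R, Before α₀ α → dist (x α) y < ε

/-! ### `ℕ^{(m)}`-sequences and `𝓡`-limits -/

/-- `ℕ^{(m)}`, the family of `m`-element subsets of `ℕ`. -/
abbrev MSubsets (m : ℕ) : Type := {α : Finset ℕ // α.card = m}

/-- `𝓡-lim_{α ∈ S^{(m)}} x_α = y`. -/
def RLim {Y : Type*} [PseudoMetricSpace Y] {m : ℕ} (S : Set ℕ) (x : MSubsets m → Y) (y : Y) :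
    Prop :=
  ∀ ε > 0, ∃ α₀ : MSubsets m, ∀ α : MSubsets m, (α.1 : Set ℕ) ⊆ S → Before α₀.1 α.1 →
    dist (x α) y < ε

section Sigma

variable {G : Type*} [AddCommGroup G] {m : ℕ}

/-- For a sequence `(g_{k,1}, …, g_{k,m})_k` in `G^m` and `α = {k_1 < ⋯ < k_m}`,
`g_α = g_{k_1,1} + ⋯ + g_{k_m,m}`. -/
def sigmaSum (g : ℕ → Fin m → G) (α : MSubsets m) : G :=
  ∑ t : Fin m, g (α.1.orderEmbOfFin α.2 t) t

/-- A non-degenerated sequence in `G^m`: each coordinate tends to infinity in the discrete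
group `G`. -/
def NonDegenerated (g : ℕ → Fin m → G) : Prop :=
  ∀ t, Tendsto (fun k => g k t) atTop cofinite

/-- Two sequences in `G^m` are essentially distinct: in each coordinate they grow apart. -/
def EssentiallyDistinct (g h : ℕ → Fin m → G) : Prop :=
  ∀ t, Tendsto (fun k => g k t - h k t) atTop cofinite

end Sigma

/-! ### Measure preserving systems

The action `(T_g)` is a Mathlib `AddAction`, `T_g x = g +ᵥ x`, and `T_g A = g +ᵥ A` for sets. -/

section System

variable {X : Type*} [MeasurableSpace X]

/-- The mixing property of a sequence of transformations. -/
def HasMixingProperty (T : ℕ → X → X) (μ : Measure X) : Prop :=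
  ∀ A₀ A₁ : Set X, MeasurableSet A₀ → MeasurableSet A₁ →
    Tendsto (fun k => μ.real (A₀ ∩ T k ⁻¹' A₁)) atTop (𝓝 (μ.real A₀ * μ.real A₁))

variable {G : Type*} [AddCommGroup G] [AddAction G X]

variable (G) in
/-- Mild mixing: whenever `lim_{α → ∞} g_α = ∞`, there is an IP-ring along which
`T_{g_α} f = f ∘ T_{g_α}` converges weakly in `L²(μ)` to the constant `∫ f dμ`,
for every `f ∈ L²(μ)`. -/
def IsMildlyMixing (μ : Measure X) : Prop :=
  ∀ g : ℕ → G, IPTendstoInfty (ipSum g) →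
    ∃ R : Set (Finset ℕ), IsIPRing R ∧
      ∀ f : X → ℂ, MemLp f 2 μ → ∀ h : X → ℂ, MemLp h 2 μ →
        IPLim R (fun α => ∫ x, f (ipSum g α +ᵥ x) * (starRingEnd ℂ) (h x) ∂μ)
          (∫ x, (∫ y, f y ∂μ) * (starRingEnd ℂ) (h x) ∂μ)

/-- `μ(A_0 ∩ T_{g_1} A_1 ∩ ⋯ ∩ T_{g_ℓ} A_ℓ)`. -/
noncomputable def multiCorr (μ : Measure X) {ℓ : ℕ} (A : Fin (ℓ + 1) → Set X) (g : Fin ℓ → G) :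
    ℝ :=
  μ.real (A 0 ∩ ⋂ j : Fin ℓ, (g j +ᵥ A j.succ))

variable (G) in
/-- `R_ε(A_0, …, A_ℓ) ⊆ G^ℓ`. -/
def returnSet (μ : Measure X) {ℓ : ℕ} (ε : ℝ) (A : Fin (ℓ + 1) → Set X) : Set (Fin ℓ → G) :=
  {g | |multiCorr μ A g - ∏ j, μ.real (A j)| < ε}

end System

end MildMixing

/-!
Mild mixing says that pair correlations recur: the sets `{c | |μ(A ∩ T_c B) - μ(A) μ(B)| < ε}` meet
every set of finite sums of a sequence whose finite sums tend to infinity. Along an idempotent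
ultrafilter of `(𝓕, ∪)` recurrence improves to convergence, because by the Galvin–Glazer argument
the complement of a set outside the ultrafilter contains an IP-ring. The van der Corput trick along
the ultrafilter then reduces correlations of `n + 1` sets to correlations of `n` sets, so translates
along sequences whose differences tend to infinity become jointly independent, and separability of
`μ` allows one to extract a single IP-ring that works for all sets at once.

Conversely, each statement yields recurrence in the first coordinate of every `ĨP` set, and the
finite sums of any sequence contain such first coordinates: cut the sequence into blocks of equal
length, and let the `j`-th coordinate sum the first `j` terms of each block.
-/

namespace MildMixing

/-! ### The filter `α → ∞` -/

/-- The filter of tails of `𝓕`: limits along it are the limits `α → ∞` of `𝓕`-sequences. -/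
def ipAtTop : Filter (Finset ℕ) := ⨅ n : ℕ, 𝓟 {α | α.Nonempty ∧ ∀ i ∈ α, n ≤ i}

theorem hasBasis_ipAtTop : ipAtTop.HasBasis (fun _ : ℕ => True)
    fun n => {α | α.Nonempty ∧ ∀ i ∈ α, n ≤ i} :=
  hasBasis_iInf_principal (directed_of_isDirected_le fun _ _ hmn _ hα =>
    ⟨hα.1, fun i hi => hmn.trans (hα.2 i hi)⟩)

theorem eventually_ipAtTop_iff {P : Finset ℕ → Prop} :
    (∀ᶠ α in ipAtTop, P α) ↔ ∃ n, ∀ α : Finset ℕ, α.Nonempty → (∀ i ∈ α, n ≤ i) → P α := by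
  simp only [hasBasis_ipAtTop.eventually_iff, Set.mem_ofPred_eq, and_imp, true_and]

theorem eventually_nonempty : ∀ᶠ α in ipAtTop, α.Nonempty :=
  eventually_ipAtTop_iff.2 ⟨0, fun _ hα _ => hα⟩

theorem eventually_before (β : Finset ℕ) : ∀ᶠ α in ipAtTop, Before β α :=
  eventually_ipAtTop_iff.2 ⟨β.sup id + 1, fun _ _ hα _ hb _ ha =>
    (Finset.le_sup (f := id) hb).trans_lt (hα _ ha)⟩

theorem tendsto_singleton_ipAtTop : Tendsto (fun k : ℕ => ({k} : Finset ℕ)) atTop ipAtTop := by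
  refine hasBasis_ipAtTop.tendsto_right_iff.2 fun n _ => ?_
  filter_upwards [eventually_ge_atTop n] with k hk
  simpa using hk

instance : ipAtTop.NeBot := tendsto_singleton_ipAtTop.neBot

theorem ipTendstoInfty_iff {G : Type*} {x : Finset ℕ → G} :
    IPTendstoInfty x ↔ Tendsto x ipAtTop cofinite := by
  constructor
  · intro h s hs
    obtain ⟨α₀, -, hα₀⟩ := h (mem_cofinite.1 hs).toFinset
    refine mem_map.2 ?_
    filter_upwards [eventually_nonempty, eventually_before α₀] with α hα hb
    simpa using hα₀ α hα hb
  · intro h K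
    obtain ⟨n, hn⟩ := eventually_ipAtTop_iff.1 (h K.finite_toSet.compl_mem_cofinite)
    exact ⟨{n}, Finset.singleton_nonempty n, fun α hα hb =>
      hn α hα fun i hi => (hb n (Finset.mem_singleton_self n) i hi).le⟩

section Sums

variable {G : Type*} [AddCommGroup G]

theorem ipSum_sub (g h : ℕ → G) : ipSum (g - h) = ipSum g - ipSum h :=
  funext fun _ => Finset.sum_sub_distrib _ _

theorem ipSum_zero : ipSum (0 : ℕ → G) = 0 := funext fun _ => Finset.sum_const_zero

theorem ipSum_union (g : ℕ → G) {α β : Finset ℕ} (h : Before α β) :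
    ipSum g (α ∪ β) = ipSum g α + ipSum g β :=
  Finset.sum_union (Finset.disjoint_left.2 fun i hα hβ => (h i hα i hβ).false)

end Sums

/-- `a` is a sequence `a 0 < a 1 < ⋯` in `𝓕`; its finite unions form an IP-ring. -/
structure IsRingBase (a : ℕ → Finset ℕ) : Prop where
  nonempty : ∀ k, (a k).Nonempty
  before : ∀ k, Before (a k) (a (k + 1))

/-- The IP-ring generated by `a`. -/
def ringOf (a : ℕ → Finset ℕ) : Set (Finset ℕ) :=
  {β | ∃ α : Finset ℕ, α.Nonempty ∧ β = α.biUnion a}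

namespace IsRingBase

variable {a : ℕ → Finset ℕ} (ha : IsRingBase a)
include ha

theorem isIPRing : IsIPRing (ringOf a) := ⟨a, ha.nonempty, ha.before, rfl⟩

theorem before_of_lt {k l : ℕ} (h : k < l) : Before (a k) (a l) := by
  induction l, h using Nat.le_induction with
  | base => exact ha.before k
  | succ l _ ih =>
    intro x hx y hy
    obtain ⟨z, hz⟩ := ha.nonempty l
    exact (ih x hx z hz).trans (ha.before l z hz y hy)

theorem le_of_mem {k i : ℕ} (hi : i ∈ a k) : k ≤ i := by
  induction k generalizing i with
  | zero => exact Nat.zero_le i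
  | succ k ih =>
    obtain ⟨z, hz⟩ := ha.nonempty k
    exact (Nat.succ_le_succ (ih hz)).trans (ha.before k z hz i hi)

theorem le_sup_of_mem {k l i : ℕ} (h : k ≤ l) (hi : i ∈ a k) : i ≤ (a l).sup id := by
  obtain rfl | hlt := h.eq_or_lt
  · exact Finset.le_sup (f := id) hi
  · obtain ⟨z, hz⟩ := ha.nonempty l
    exact (ha.before_of_lt hlt i hi z hz).le.trans (Finset.le_sup (f := id) hz)

theorem disjoint {k l : ℕ} (h : k ≠ l) : Disjoint (a k) (a l) := by
  wlog hlt : k < l generalizing k l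
  · exact (this h.symm (h.lt_or_gt.resolve_left hlt)).symm
  · exact Finset.disjoint_left.2 fun x hk hl => (ha.before_of_lt hlt x hk x hl).false

theorem ipSum_biUnion {G : Type*} [AddCommGroup G] (g : ℕ → G) (α : Finset ℕ) :
    ipSum g (α.biUnion a) = ipSum (fun k => ipSum g (a k)) α :=
  Finset.sum_biUnion fun _ _ _ _ h => ha.disjoint h

theorem tendsto_biUnion : Tendsto (fun α : Finset ℕ => α.biUnion a) ipAtTop ipAtTop := by
  refine hasBasis_ipAtTop.tendsto_iff hasBasis_ipAtTop |>.2 fun n _ =>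
    ⟨n, trivial, fun α hα => ⟨hα.1.biUnion fun k _ => ha.nonempty k, fun i hi => ?_⟩⟩
  obtain ⟨k, hk, hik⟩ := Finset.mem_biUnion.1 hi
  exact (hα.2 k hk).trans (ha.le_of_mem hik)

theorem tendsto_atTop : Tendsto a atTop ipAtTop := by
  simpa only [Function.comp_def, Finset.singleton_biUnion] using
    ha.tendsto_biUnion.comp tendsto_singleton_ipAtTop

theorem ipTendstoInfty {G : Type*} [AddCommGroup G] {g : ℕ → G}
    (hg : IPTendstoInfty (ipSum g)) : IPTendstoInfty (ipSum fun k => ipSum g (a k)) :=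
  ipTendstoInfty_iff.2 <| ((ipTendstoInfty_iff.1 hg).comp ha.tendsto_biUnion).congr
    (ha.ipSum_biUnion g)

theorem ipLim_iff {Y : Type*} [PseudoMetricSpace Y] {x : Finset ℕ → Y} {y : Y} :
    IPLim (ringOf a) x y ↔ Tendsto (fun α => x (α.biUnion a)) ipAtTop (𝓝 y) := by
  refine Iff.trans (forall₂_congr fun ε _ => ⟨?_, ?_⟩) Metric.tendsto_nhds.symm
  · rintro ⟨α₀, -, h⟩
    filter_upwards [eventually_nonempty, ha.tendsto_biUnion.eventually (eventually_before α₀)]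
      with α hα hb using h _ ⟨α, hα, rfl⟩ hb
  · intro h
    obtain ⟨n, hn⟩ := eventually_ipAtTop_iff.1 h
    refine ⟨a n, ⟨{n}, Finset.singleton_nonempty n, Finset.singleton_biUnion.symm⟩, ?_⟩
    rintro _ ⟨α, hα, rfl⟩ hb
    refine hn α hα fun k hk => ?_
    by_contra! hlt
    obtain ⟨x, hx⟩ := ha.nonempty k
    obtain ⟨y, hy⟩ := ha.nonempty n
    exact (hb y hy x (Finset.mem_biUnion.2 ⟨k, hk, hx⟩)).asymm (ha.before_of_lt hlt x hx y hy)

end IsRingBase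

theorem IsIPRing.exists_isRingBase {R : Set (Finset ℕ)} (hR : IsIPRing R) :
    ∃ a, IsRingBase a ∧ R = ringOf a :=
  let ⟨a, hne, hbefore, hR⟩ := hR
  ⟨a, ⟨hne, hbefore⟩, hR⟩

/-! ### IP-ultrafilters -/

/-- An idempotent of the semigroup of ultrafilters on `(𝓕, ∪)` that contains all tails of `𝓕`. -/
structure IsIPUltrafilter (p : Ultrafilter (Finset ℕ)) : Prop where
  le_ipAtTop : ↑p ≤ ipAtTop
  eventually_union : ∀ {P : Finset ℕ → Prop}, (∀ᶠ α in p, P α) → ∀ᶠ α in p, ∀ᶠ β in p, P (α ∪ β)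

theorem exists_idempotent_ultrafilter_le {M : Type*} [Semigroup M] {F : Filter M} [F.NeBot]
    (hF : ∀ s ∈ F, ∀ᶠ a in F, ∀ᶠ b in F, a * b ∈ s) :
    ∃ p : Ultrafilter M, ↑p ≤ F ∧ ∀ {P : M → Prop}, (∀ᶠ a in p, P a) →
      ∀ᶠ a in p, ∀ᶠ b in p, P (a * b) := by
  let _ : Semigroup (Ultrafilter M) := Ultrafilter.semigroup
  have isClosed_le : IsClosed {U : Ultrafilter M | ↑U ≤ F} := by
    simp only [Filter.le_def, Set.ofPred_forall]
    exact isClosed_biInter fun s _ => ultrafilter_isClosed_basic s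
  obtain ⟨p, hp, hidem⟩ := exists_idempotent_in_compact_subsemigroup
    Ultrafilter.continuous_mul_left {U : Ultrafilter M | ↑U ≤ F} ⟨.of F, Ultrafilter.of_le F⟩
    isClosed_le.isCompact fun U hU V hV s hs =>
      (Ultrafilter.eventually_mul U V (· ∈ s)).2 <|
        Filter.Eventually.mono (hU (hF s hs)) fun _ hb => hV hb
  exact ⟨p, hp, fun hP => (Ultrafilter.eventually_mul p p _).1 (hidem.symm ▸ hP)⟩

theorem exists_isIPUltrafilter : ∃ p, IsIPUltrafilter p := by
  have union_mem : ∀ s ∈ ipAtTop, ∀ᶠ α in ipAtTop, ∀ᶠ β in ipAtTop, α ∪ β ∈ s := by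
    intro s hs
    obtain ⟨n, -, hn⟩ := hasBasis_ipAtTop.mem_iff.1 hs
    have htail := hasBasis_ipAtTop.mem_of_mem (i := n) trivial
    filter_upwards [htail] with α hα
    filter_upwards [htail] with β hβ
    exact hn ⟨hα.1.mono Finset.subset_union_left,
      fun i hi => (Finset.mem_union.1 hi).elim (hα.2 i) (hβ.2 i)⟩
  obtain ⟨p, hle, hidem⟩ := @exists_idempotent_ultrafilter_le (Finset ℕ)
    { mul := (· ∪ ·), mul_assoc := Finset.union_assoc } ipAtTop _ union_mem
  exact ⟨p, hle, hidem⟩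

/-- The sets from which the Galvin–Glazer construction can choose its next member of `𝓕`: they are
large, and each of their members has a large set of unions with it inside them. -/
def IsStable (p : Ultrafilter (Finset ℕ)) (D : Set (Finset ℕ)) : Prop :=
  D ∈ p ∧ ∀ α ∈ D, ∀ᶠ β in p, α ∪ β ∈ D

namespace IsIPUltrafilter

variable {p : Ultrafilter (Finset ℕ)} (hp : IsIPUltrafilter p)

include hp

theorem exists_isStable_subset {S : Set (Finset ℕ)} (hS : S ∈ p) : ∃ D ⊆ S, IsStable p D := by
  refine ⟨{α | α ∈ S ∧ ∀ᶠ β in p, α ∪ β ∈ S}, fun _ hα => hα.1,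
    inter_mem hS (hp.eventually_union hS), fun α hα => ?_⟩
  filter_upwards [hα.2, hp.eventually_union hα.2] with β hβ hβγ
  simpa only [Set.mem_ofPred_eq, Finset.union_assoc] using And.intro hβ hβγ

theorem exists_isStable_step (T : Finset ℕ → Set (Finset ℕ)) (hT : ∀ β, T β ∈ p)
    {D : Set (Finset ℕ)} (hD : IsStable p D) :
    ∃ α ∈ D, α.Nonempty ∧ ∃ D' ⊆ D, IsStable p D' ∧
      ∀ β ∈ D', α ∪ β ∈ D ∧ β ∈ T α ∧ Before α β := by
  obtain ⟨α, hαD, hα⟩ :=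
    (Filter.Eventually.and hD.1 (hp.le_ipAtTop eventually_nonempty)).exists
  obtain ⟨D', hsub, hD'⟩ := hp.exists_isStable_subset <| inter_mem hD.1 <|
    inter_mem (hD.2 α hαD) <| inter_mem (hT α) <| hp.le_ipAtTop (eventually_before α)
  exact ⟨α, hαD, hα, D', fun _ hβ => (hsub hβ).1, hD', fun _ hβ => (hsub hβ).2⟩

theorem galvin_glazer {S : Set (Finset ℕ)} (hS : S ∈ p) {T : Finset ℕ → Set (Finset ℕ)}
    (hT : ∀ β, T β ∈ p) :
    ∃ a : ℕ → Finset ℕ, IsRingBase a ∧ (∀ α : Finset ℕ, α.Nonempty → α.biUnion a ∈ S) ∧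
      ∀ k, ∀ α : Finset ℕ, α.Nonempty → (∀ i ∈ α, k < i) → α.biUnion a ∈ T (a k) := by
  obtain ⟨D₀, hD₀S, hD₀⟩ := hp.exists_isStable_subset hS
  choose pick pick_mem pick_nonempty next next_subset next_stable hnext using
    fun D : {D // IsStable p D} => hp.exists_isStable_step T hT D.2
  let D : ℕ → {D // IsStable p D} := Nat.rec ⟨D₀, hD₀⟩ fun _ D => ⟨next D, next_stable D⟩
  have hanti : Antitone fun n => (D n).1 := antitone_nat_of_succ_le fun n => next_subset (D n)
  let a : ℕ → Finset ℕ := fun n => pick (D n)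
  have biUnion_mem : ∀ α : Finset ℕ, ∀ n, α.Nonempty → (∀ i ∈ α, n ≤ i) →
      α.biUnion a ∈ (D n).1 := by
    intro α
    induction α using Finset.induction_on_min with
    | empty => exact fun n h => absurd h Finset.not_nonempty_empty
    | insert k α hk ih =>
      intro n _ hn
      refine hanti (hn k (Finset.mem_insert_self _ _)) ?_
      rw [Finset.biUnion_insert]
      rcases α.eq_empty_or_nonempty with rfl | hα
      · simpa using pick_mem (D k)
      · exact (hnext (D k) _ (ih (k + 1) hα hk)).1
  refine ⟨a, ⟨fun k => pick_nonempty (D k), fun k => ?_⟩, fun α hα => ?_, fun k α hα h => ?_⟩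
  · exact (hnext (D k) _ (pick_mem (D (k + 1)))).2.2
  · exact hD₀S (biUnion_mem α 0 hα fun i _ => i.zero_le)
  · exact (hnext (D k) _ (biUnion_mem α (k + 1) hα h)).2.1

theorem exists_isRingBase {R : Finset ℕ → Finset ℕ → Prop} (hR : ∀ᶠ α in p, ∀ᶠ β in p, R α β) :
    ∃ a, IsRingBase a ∧ ∀ α β : Finset ℕ, α.Nonempty → β.Nonempty → Before α β →
      R (α.biUnion a) (β.biUnion a) := by
  let S : Set (Finset ℕ) := {α | ∀ᶠ β in p, R α β}
  have hT (β : Finset ℕ) : ∀ᶠ δ in p, ∀ γ ∈ (Finset.range (β.sup id + 1)).powerset, γ ∈ S →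
      R γ δ :=
    (Filter.eventually_all_finset _).2 fun γ _ => eventually_imp_distrib_left.2 id
  obtain ⟨a, ha, hS, hT⟩ := hp.galvin_glazer (S := S) hR hT
  refine ⟨a, ha, fun α β hα hβ hαβ => ?_⟩
  refine hT (α.max' hα) β hβ (hαβ _ (α.max'_mem hα)) _ (Finset.mem_powerset.2 fun i hi => ?_)
    (hS α hα)
  obtain ⟨k, hk, hik⟩ := Finset.mem_biUnion.1 hi
  exact Finset.mem_range_succ_iff.2 (ha.le_sup_of_mem (α.le_max' k hk) hik)

theorem exists_isRingBase_forall {S : Set (Finset ℕ)} (hS : S ∈ p) :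
    ∃ a, IsRingBase a ∧ ∀ α : Finset ℕ, α.Nonempty → α.biUnion a ∈ S :=
  let ⟨a, ha, haS, _⟩ := hp.galvin_glazer hS (T := fun _ => Set.univ) fun _ => univ_mem
  ⟨a, ha, haS⟩

theorem exists_isRingBase_tendsto {Y : Type*} {l : Filter Y} [l.IsCountablyGenerated]
    {x : Finset ℕ → Y} (hx : Tendsto x p l) :
    ∃ a, IsRingBase a ∧ Tendsto (fun α : Finset ℕ => x (α.biUnion a)) ipAtTop l := by
  obtain ⟨U, hU⟩ := l.exists_antitone_basis
  obtain ⟨a, ha, haT⟩ := hp.exists_isRingBase (R := fun α β => x β ∈ U (α.sup id)) <|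
    .of_forall fun α => hx (hU.mem _)
  refine ⟨a, ha, hU.tendsto_right_iff.2 fun n _ => ?_⟩
  filter_upwards [eventually_nonempty, eventually_before {n}] with α hα hn
  refine hU.antitone ?_ (haT {n} α (Finset.singleton_nonempty n) hα hn)
  obtain ⟨i, hi⟩ := ha.nonempty n
  rw [Finset.singleton_biUnion]
  exact (ha.le_of_mem hi).trans (Finset.le_sup (f := id) hi)

theorem tendsto_of_forall_exists {G Y : Type*} [AddCommGroup G] {φ : G → Y} {l : Filter Y}
    (h : ∀ g : ℕ → G, IPTendstoInfty (ipSum g) → ∀ U ∈ l,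
      ∃ α : Finset ℕ, α.Nonempty ∧ φ (ipSum g α) ∈ U)
    {g : ℕ → G} (hg : IPTendstoInfty (ipSum g)) : Tendsto (fun α => φ (ipSum g α)) p l := by
  intro U hU
  by_contra hcon
  obtain ⟨a, ha, hS⟩ := hp.exists_isRingBase_forall (Ultrafilter.eventually_not.2 hcon)
  obtain ⟨α, hα, hαU⟩ := h _ (ha.ipTendstoInfty hg) U hU
  exact hS α hα (by simpa only [ha.ipSum_biUnion] using hαU)

end IsIPUltrafilter

/-! ### A van der Corput lemma -/

section VanDerCorput

variable {E : Type*} [NormedAddCommGroup E] [InnerProductSpace ℝ E] {K δ ε : ℝ}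

theorem norm_sq_sum_range_le {u : ℕ → E} {N : ℕ} (hδ : 0 ≤ δ) (hK : ∀ i, ‖u i‖ ≤ K)
    (h : ∀ i j, i < j → j < N → inner ℝ (u i) (u j) ≤ δ) :
    ‖∑ i ∈ Finset.range N, u i‖ ^ 2 ≤ N * K ^ 2 + N ^ 2 * δ := by
  have inner_le (i) (hi : i ∈ Finset.range N) (j) (hj : j ∈ Finset.range N) :
      inner ℝ (u i) (u j) ≤ (if i = j then K ^ 2 else 0) + δ := by
    rw [Finset.mem_range] at hi hj
    rcases lt_trichotomy i j with hij | rfl | hij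
    · simpa [hij.ne] using h i j hij hj
    · rw [real_inner_self_eq_norm_sq, if_pos rfl]
      linarith [pow_le_pow_left₀ (norm_nonneg _) (hK i) 2]
    · rw [real_inner_comm]
      simpa [hij.ne'] using h j i hij hi
  calc ‖∑ i ∈ Finset.range N, u i‖ ^ 2
      = ∑ i ∈ Finset.range N, ∑ j ∈ Finset.range N, inner ℝ (u i) (u j) := by
        simp_rw [← real_inner_self_eq_norm_sq, sum_inner, inner_sum]
    _ ≤ ∑ i ∈ Finset.range N, ∑ j ∈ Finset.range N, ((if i = j then K ^ 2 else 0) + δ) :=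
        Finset.sum_le_sum fun i hi => Finset.sum_le_sum (inner_le i hi)
    _ = ∑ i ∈ Finset.range N, (K ^ 2 + N * δ) := by
        refine Finset.sum_congr rfl fun i hi => ?_
        rw [Finset.sum_add_distrib, Finset.sum_ite_eq, if_pos hi, Finset.sum_const,
          Finset.card_range, nsmul_eq_mul]
    _ = N * K ^ 2 + N ^ 2 * δ := by
        rw [Finset.sum_const, Finset.card_range, nsmul_eq_mul]
        ring

theorem sq_le_of_forall_le_inner {u : ℕ → E} {v : E} {N : ℕ} (hN : 0 < N) (hδ : 0 ≤ δ)
    (hε : 0 ≤ ε) (hK : ∀ i, ‖u i‖ ≤ K) (h : ∀ i j, i < j → j < N → inner ℝ (u i) (u j) ≤ δ)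
    (hv : ∀ i < N, ε ≤ inner ℝ (u i) v) : ε ^ 2 ≤ (K ^ 2 / N + δ) * ‖v‖ ^ 2 := by
  have hsum : N * ε ≤ ‖∑ i ∈ Finset.range N, u i‖ * ‖v‖ := by
    refine le_trans ?_ (real_inner_le_norm _ _)
    rw [sum_inner, ← nsmul_eq_mul]
    simpa using Finset.card_nsmul_le_sum (Finset.range N) _ ε fun i hi =>
      hv i (Finset.mem_range.1 hi)
  have hN : (0 : ℝ) < N := Nat.cast_pos.2 hN
  refine le_of_mul_le_mul_left ?_ (pow_pos hN 2)
  calc (N : ℝ) ^ 2 * ε ^ 2 ≤ ‖∑ i ∈ Finset.range N, u i‖ ^ 2 * ‖v‖ ^ 2 := by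
        rw [← mul_pow, ← mul_pow]
        gcongr
    _ ≤ (N * K ^ 2 + N ^ 2 * δ) * ‖v‖ ^ 2 := by
        gcongr
        exact norm_sq_sum_range_le hδ hK h
    _ = N ^ 2 * ((K ^ 2 / N + δ) * ‖v‖ ^ 2) := by field_simp

variable {p : Ultrafilter (Finset ℕ)} {x : Finset ℕ → E}

theorem IsIPUltrafilter.eventually_inner_lt (hp : IsIPUltrafilter p) (hK : ∀ α, ‖x α‖ ≤ K)
    (h : ∀ δ > 0, ∀ᶠ β in p, ∀ᶠ α in p, inner ℝ (x (β ∪ α)) (x α) ≤ δ) (v : E) (hε : 0 < ε) :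
    ∀ᶠ α in p, inner ℝ (x α) v < ε := by
  by_contra hcon
  obtain ⟨δ, hδ, hδv⟩ := exists_pos_mul_lt (pow_pos hε 2) (‖v‖ ^ 2)
  obtain ⟨a, -, ha⟩ := hp.exists_isRingBase
    (R := fun β α => inner ℝ (x (β ∪ α)) (x α) ≤ δ ∧ ε ≤ inner ℝ (x β) v) <| by
    filter_upwards [h δ hδ, Ultrafilter.eventually_not.2 hcon] with β hβ hβv
    exact hβ.mono fun α hα => ⟨hα, not_lt.1 hβv⟩
  have before {i j k : ℕ} : Before (Finset.Ico i j) (Finset.Ico j k) := fun m hm n hn =>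
    (Finset.mem_Ico.1 hm).2.trans_le (Finset.mem_Ico.1 hn).1
  have sq_le (N : ℕ) (hN : 0 < N) : ε ^ 2 ≤ (K ^ 2 / N + δ) * ‖v‖ ^ 2 := by
    refine sq_le_of_forall_le_inner (u := fun i => x ((Finset.Ico i N).biUnion a)) hN hδ.le hε.le
      (fun i => hK _) (fun i j hij hj => ?_) fun i hi => ?_
    · have hle := (ha _ _ (Finset.nonempty_Ico.2 hij) (Finset.nonempty_Ico.2 hj) before).1
      rwa [← Finset.union_biUnion, Finset.Ico_union_Ico_eq_Ico hij.le hj.le] at hle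
    · exact (ha _ _ (Finset.nonempty_Ico.2 hi) (Finset.nonempty_Ico.2 N.lt_succ_self) before).2
  have tendsto_bound : Tendsto (fun N : ℕ => (K ^ 2 / N + δ) * ‖v‖ ^ 2) atTop
      (𝓝 (δ * ‖v‖ ^ 2)) := by
    simpa using ((tendsto_const_div_atTop_nhds_zero_nat (K ^ 2)).add_const δ).mul_const (‖v‖ ^ 2)
  have : ε ^ 2 ≤ δ * ‖v‖ ^ 2 :=
    ge_of_tendsto tendsto_bound ((eventually_gt_atTop 0).mono sq_le)
  linarith

theorem IsIPUltrafilter.tendsto_inner_zero (hp : IsIPUltrafilter p) (hK : ∀ α, ‖x α‖ ≤ K)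
    (h : ∀ δ > 0, ∀ᶠ β in p, ∀ᶠ α in p, inner ℝ (x (β ∪ α)) (x α) ≤ δ) (v : E) :
    Tendsto (fun α => inner ℝ (x α) v) p (𝓝 0) := by
  refine Metric.tendsto_nhds.2 fun ε hε => ?_
  filter_upwards [hp.eventually_inner_lt hK h v hε, hp.eventually_inner_lt hK h (-v) hε]
    with α hlt hneg
  rw [inner_neg_right] at hneg
  rw [Real.dist_eq, sub_zero, abs_lt]
  exact ⟨by linarith, hlt⟩

end VanDerCorput

/-! ### Dispersed sequences -/

section Dispersed

variable {G : Type*} [AddCommGroup G] {ι : Type*} {n : ℕ}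

/-- The differences of the sequences `c j` are IP-sequences tending to infinity. This is the
translation invariant form of `IsIPTildeGenerator`. -/
def IsIPDispersed (c : ι → ℕ → G) : Prop :=
  ∀ i j, i ≠ j → IPTendstoInfty (ipSum (c j - c i))

theorem IPTendstoInfty.ipSum_sub_comm {g h : ℕ → G} (hgh : IPTendstoInfty (ipSum (g - h))) :
    IPTendstoInfty (ipSum (h - g)) := by
  have neg_eq : ipSum (h - g) = fun α => -ipSum (g - h) α := by
    simp only [ipSum_sub, Pi.sub_apply, neg_sub]
    rfl
  rw [ipTendstoInfty_iff] at hgh ⊢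
  rw [neg_eq]
  exact neg_injective.tendsto_cofinite.comp hgh

theorem isIPDispersed_of_lt [LinearOrder ι] {c : ι → ℕ → G}
    (h : ∀ i j, i < j → IPTendstoInfty (ipSum (c j - c i))) : IsIPDispersed c := fun i j hij =>
  hij.lt_or_gt.elim (h i j) fun hji => (h j i hji).ipSum_sub_comm

theorem isIPTildeGenerator_iff {g : Fin n → ℕ → G} :
    IsIPTildeGenerator g ↔ (∀ j, IPTendstoInfty (ipSum (g j))) ∧ IsIPDispersed g := by
  simp only [IsIPTildeGenerator, IsIPDispersed, ipSum_sub]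
  rfl

theorem isIPDispersed_vecCons_zero {g : Fin n → ℕ → G} :
    IsIPDispersed (Matrix.vecCons 0 g) ↔ IsIPTildeGenerator g := by
  rw [isIPTildeGenerator_iff]
  constructor
  · refine fun h => ⟨fun j => ?_, fun i j hij => ?_⟩
    · simpa using h 0 j.succ (Fin.succ_ne_zero j).symm
    · simpa using h i.succ j.succ (by simpa using hij)
  · refine fun h => isIPDispersed_of_lt fun i j hij => ?_
    obtain ⟨j, rfl⟩ := Fin.exists_succ_eq.2 (Fin.ne_zero_of_lt hij)
    refine Fin.cases (fun _ => ?_) (fun i hij => ?_) i hij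
    · simpa using h.1 j
    · simpa using h.2 i j (Fin.succ_lt_succ_iff.1 hij).ne

theorem IsIPDispersed.isIPTildeGenerator {c : Fin (n + 1) → ℕ → G} (hc : IsIPDispersed c) :
    IsIPTildeGenerator fun j => c (Fin.succ j) - c 0 := by
  refine isIPTildeGenerator_iff.2 ⟨fun j => hc _ _ (Fin.succ_ne_zero j).symm, fun i j hij => ?_⟩
  simpa using hc i.succ j.succ (by simpa using hij)

/-- The sequences `∑_{n k ≤ i < n k + j} g i`, `j < n`, whose differences are sums of `g` over
the terms of a ring base. -/
def blockSum (n : ℕ) (g : ℕ → G) (j : Fin n) (k : ℕ) : G :=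
  ipSum g (Finset.Ico (n * k) (n * k + j))

theorem isRingBase_block {i j : Fin n} (h : i < j) :
    IsRingBase fun k => Finset.Ico (n * k + i) (n * k + j) where
  nonempty k := Finset.nonempty_Ico.2 (by simpa using h)
  before k a ha b hb := by
    have := j.2
    rw [Finset.mem_Ico] at ha hb
    rw [mul_add, mul_one] at hb
    omega

theorem blockSum_sub_blockSum (g : ℕ → G) {i j : Fin n} (h : i < j) :
    blockSum n g j - blockSum n g i =
      fun k => ipSum g (Finset.Ico (n * k + i) (n * k + j)) := by
  ext k
  exact sub_eq_of_eq_add' (Finset.sum_Ico_consecutive g (Nat.le_add_right _ _)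
    (by simpa using h.le)).symm

theorem isIPDispersed_blockSum {g : ℕ → G} (hg : IPTendstoInfty (ipSum g)) :
    IsIPDispersed (blockSum n g) :=
  isIPDispersed_of_lt fun i j hij => by
    rw [blockSum_sub_blockSum g hij]
    exact (isRingBase_block hij).ipTendstoInfty hg

theorem exists_isIPTildeGenerator {g : ℕ → G} (hg : IPTendstoInfty (ipSum g)) (n : ℕ) :
    ∃ h : Fin (n + 1) → ℕ → G, IsIPTildeGenerator h ∧ ∀ α : Finset ℕ, α.Nonempty →
      ∃ β : Finset ℕ, β.Nonempty ∧ ipSum (h 0) α = ipSum g β := by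
  refine ⟨_, (isIPDispersed_blockSum (n := n + 2) hg).isIPTildeGenerator, fun α hα => ?_⟩
  have zero_lt : (0 : Fin (n + 2)) < 1 := Fin.zero_lt_one
  have hbase := isRingBase_block zero_lt
  refine ⟨_, hα.biUnion fun k _ => hbase.nonempty k, ?_⟩
  rw [hbase.ipSum_biUnion, ← blockSum_sub_blockSum g zero_lt]
  rfl

end Dispersed

/-! ### Multiple correlations -/

section Correlation

variable {G : Type*} [AddCommGroup G] {X : Type*} [MeasurableSpace X] [AddAction G X]
  {ι : Type*} {n : ℕ}

/-- The multiple correlation `μ(⋂_j T_{c_j} A_j)`, in which, unlike in `multiCorr`, no set is left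
in place. -/
noncomputable def interCorr (μ : Measure X) (A : ι → Set X) (c : ι → G) : ℝ :=
  μ.real (⋂ j, c j +ᵥ A j)

variable {μ : Measure X}

theorem multiCorr_eq_interCorr (A : Fin (n + 1) → Set X) (g : Fin n → G) :
    multiCorr μ A g = interCorr μ A (Matrix.vecCons 0 g) := by
  rw [multiCorr, interCorr]
  congr 1
  ext x
  simp [Fin.forall_fin_succ]

theorem multiCorr_ipSum (A : Fin (n + 1) → Set X) (g : Fin n → ℕ → G) (α : Finset ℕ) :
    multiCorr μ A (fun j => ipSum (g j) α) =
      interCorr μ A fun j => ipSum (Matrix.vecCons 0 g j) α := by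
  rw [multiCorr_eq_interCorr]
  congr 1
  ext j
  exact Fin.cases (by simp [ipSum_zero]) (fun j => by simp) j

theorem measurableSet_iInter_vadd [MeasurableConstVAdd G X] [Countable ι] {A : ι → Set X}
    (hA : ∀ j, MeasurableSet (A j)) (c : ι → G) : MeasurableSet (⋂ j, c j +ᵥ A j) :=
  .iInter fun j => (hA j).const_vadd _

section Invariant

variable [VAddInvariantMeasure G X μ]

theorem measureReal_vadd (c : G) (A : Set X) : μ.real (c +ᵥ A) = μ.real A :=
  congr_arg ENNReal.toReal (measure_vadd μ c A)

theorem measureReal_inter_preimage_vadd (c : G) (A B : Set X) :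
    μ.real (A ∩ (c +ᵥ ·) ⁻¹' B) = μ.real (B ∩ (c +ᵥ A)) := by
  rw [← measureReal_vadd c, Set.vadd_set_inter, Set.preimage_vadd, vadd_neg_vadd, Set.inter_comm]

theorem interCorr_add (A : ι → Set X) (x : G) (c : ι → G) :
    interCorr μ A (fun j => x + c j) = interCorr μ A c := by
  simp only [interCorr, add_vadd, ← Set.vadd_set_iInter, measureReal_vadd]

theorem interCorr_eq_multiCorr (A : Fin (n + 1) → Set X) (c : Fin (n + 1) → G) :
    interCorr μ A c = multiCorr μ A fun j => c j.succ - c 0 := by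
  rw [multiCorr_eq_interCorr, ← interCorr_add A (c 0) (Matrix.vecCons _ _)]
  congr 1
  ext j
  exact Fin.cases (by simp) (fun j => by simp) j

variable [MeasurableConstVAdd G X] [IsFiniteMeasure μ]

theorem abs_interCorr_sub_interCorr_le [Fintype ι] {A B : ι → Set X}
    (hA : ∀ j, MeasurableSet (A j)) (hB : ∀ j, MeasurableSet (B j)) (c : ι → G) :
    |interCorr μ A c - interCorr μ B c| ≤ ∑ j, μ.real (symmDiff (A j) (B j)) := by
  have subset : symmDiff (⋂ j, c j +ᵥ A j) (⋂ j, c j +ᵥ B j) ⊆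
      ⋃ j, c j +ᵥ symmDiff (A j) (B j) := by
    intro x
    simp only [Set.mem_symmDiff, Set.mem_iInter, Set.mem_iUnion, Set.mem_vadd_set_iff_neg_vadd_mem]
    grind
  calc |interCorr μ A c - interCorr μ B c|
      ≤ μ.real (symmDiff (⋂ j, c j +ᵥ A j) (⋂ j, c j +ᵥ B j)) :=
        abs_measureReal_sub_le_measureReal_symmDiff
          (measurableSet_iInter_vadd hA c).nullMeasurableSet
          (measurableSet_iInter_vadd hB c).nullMeasurableSet
    _ ≤ ∑ j, μ.real (c j +ᵥ symmDiff (A j) (B j)) :=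
        (measureReal_mono subset).trans (measureReal_iUnion_fintype_le _)
    _ = ∑ j, μ.real (symmDiff (A j) (B j)) := by simp only [measureReal_vadd]

end Invariant

/-- Along `F`, the translates by `c b j`, `j : ι`, of any measurable sets become independent. -/
def IsJointlyMixing [Fintype ι] {β : Type*} (μ : Measure X) (F : Filter β) (c : β → ι → G) :
    Prop :=
  ∀ A : ι → Set X, (∀ j, MeasurableSet (A j)) →
    Tendsto (fun b => interCorr μ A (c b)) F (𝓝 (∏ j, μ.real (A j)))

namespace IsJointlyMixing

variable [Fintype ι] {β : Type*} {F : Filter β} {c : β → ι → G}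

variable [VAddInvariantMeasure G X μ] [IsProbabilityMeasure μ]

theorem tendsto_inter_vadd (h : IsJointlyMixing μ F c) {i j : ι} (hij : i ≠ j) {A B : Set X}
    (hA : MeasurableSet A) (hB : MeasurableSet B) :
    Tendsto (fun b => μ.real (A ∩ ((c b j - c b i) +ᵥ B))) F (𝓝 (μ.real A * μ.real B)) := by
  classical
  let S : ι → Set X := fun k => if k = i then A else if k = j then B else Set.univ
  have hS (k) : MeasurableSet (S k) := by
    simp only [S]
    split_ifs
    exacts [hA, hB, .univ]
  have prod_eq : ∏ k, μ.real (S k) = μ.real A * μ.real B := by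
    rw [Fintype.prod_eq_mul i j hij fun k hk => by simp [S, hk.1, hk.2]]
    simp [S, hij.symm]
  rw [← prod_eq]
  refine (h S hS).congr fun b => ?_
  have iInter_eq : ⋂ k, c b k +ᵥ S k = (c b i +ᵥ A) ∩ (c b j +ᵥ B) := by
    ext x
    simp only [S, Set.mem_iInter, Set.mem_inter_iff, Set.mem_vadd_set_iff_neg_vadd_mem]
    grind
  rw [interCorr, iInter_eq, ← measureReal_vadd (-c b i), Set.vadd_set_inter, neg_vadd_vadd,
    ← add_vadd, neg_add_eq_sub]

theorem tendsto_inter_preimage (h : IsJointlyMixing μ F c) {i j : ι} (hij : i ≠ j) {A B : Set X}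
    (hA : MeasurableSet A) (hB : MeasurableSet B) :
    Tendsto (fun b => μ.real (A ∩ ((c b j - c b i) +ᵥ ·) ⁻¹' B)) F (𝓝 (μ.real A * μ.real B)) := by
  simpa only [measureReal_inter_preimage_vadd, mul_comm] using h.tendsto_inter_vadd hij hB hA

end IsJointlyMixing

theorem exists_seq_tendsto_symmDiff [IsFiniteMeasure μ] {𝒟 : Set (Set X)} (h𝒟 : μ.MeasureDense 𝒟)
    {A : Set X} (hA : MeasurableSet A) :
    ∃ D : ℕ → 𝒟, Tendsto (fun n => μ.real (symmDiff A (D n))) atTop (𝓝 0) := by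
  have exists_approx (n : ℕ) : ∃ D : 𝒟, μ.real (symmDiff A D) < 1 / ((n : ℝ) + 1) := by
    obtain ⟨D, hD, hlt⟩ := h𝒟.approx A hA (by finiteness) (1 / ((n : ℝ) + 1)) (by positivity)
    exact ⟨⟨D, hD⟩, ENNReal.toReal_lt_of_lt_ofReal hlt⟩
  choose D hD using exists_approx
  exact ⟨D, squeeze_zero (fun _ => measureReal_nonneg) (fun n => (hD n).le)
    tendsto_one_div_add_atTop_nhds_zero_nat⟩

theorem isJointlyMixing_of_measureDense [Fintype ι] {β : Type*} {F : Filter β} {c : β → ι → G}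
    [MeasurableConstVAdd G X] [VAddInvariantMeasure G X μ] [IsFiniteMeasure μ]
    {𝒟 : Set (Set X)} (h𝒟 : μ.MeasureDense 𝒟)
    (h : ∀ A : ι → 𝒟, Tendsto (fun b => interCorr μ (fun j => (A j : Set X)) (c b)) F
      (𝓝 (∏ j, μ.real (A j)))) : IsJointlyMixing μ F c := by
  intro A hA
  choose D hD using fun j => exists_seq_tendsto_symmDiff h𝒟 (hA j)
  have hDm (n j) : MeasurableSet (D j n : Set X) := h𝒟.measurable _ (D j n).2
  have sum_tendsto : Tendsto (fun n => ∑ j, μ.real (symmDiff (A j) (D j n))) atTop (𝓝 0) := by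
    simpa using tendsto_finsetSum Finset.univ fun j _ => hD j
  have unif : TendstoUniformly (fun n b => interCorr μ (fun j => (D j n : Set X)) (c b))
      (fun b => interCorr μ A (c b)) atTop :=
    Metric.tendstoUniformly_iff.2 fun ε hε => (sum_tendsto.eventually_lt_const hε).mono
      fun n hn b => (abs_interCorr_sub_interCorr_le hA (hDm n) (c b)).trans_lt hn
  have prod_tendsto : Tendsto (fun n => ∏ j, μ.real (D j n : Set X)) atTop
      (𝓝 (∏ j, μ.real (A j))) := by
    refine tendsto_finsetProd _ fun j _ => tendsto_iff_dist_tendsto_zero.2 <|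
      squeeze_zero (fun _ => dist_nonneg) (fun n => ?_) (hD j)
    rw [dist_comm]
    exact abs_measureReal_sub_le_measureReal_symmDiff (hA j).nullMeasurableSet
      (hDm n j).nullMeasurableSet
  exact unif.tendsto_of_eventually_tendsto (.of_forall fun n => h fun j => D j n) prod_tendsto

end Correlation

/-! ### Joint mixing along IP-ultrafilters -/

section VanDerCorputStep

variable {X : Type*} [MeasurableSpace X] {μ : Measure X} [IsProbabilityMeasure μ]

/-- The vector `1_S - C` of `L²(μ)`. -/
noncomputable def centeredIndicator (μ : Measure X) [IsProbabilityMeasure μ] {S : Set X}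
    (hS : MeasurableSet S) (C : ℝ) : Lp ℝ 2 μ :=
  indicatorConstLp 2 hS (measure_ne_top μ S) 1 -
    C • indicatorConstLp 2 .univ (measure_ne_top μ Set.univ) 1

theorem inner_centeredIndicator_indicator {S T : Set X} (hS : MeasurableSet S)
    (hT : MeasurableSet T) (C : ℝ) :
    inner ℝ (centeredIndicator μ hS C) (indicatorConstLp 2 hT (measure_ne_top μ T) 1) =
      μ.real (S ∩ T) - C * μ.real T := by
  simp only [centeredIndicator, inner_sub_left, real_inner_smul_left,
    L2.real_inner_indicatorConstLp_one_indicatorConstLp_one, Set.univ_inter]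

theorem inner_centeredIndicator {S T : Set X} (hS : MeasurableSet S) (hT : MeasurableSet T)
    (C : ℝ) : inner ℝ (centeredIndicator μ hS C) (centeredIndicator μ hT C) =
      μ.real (S ∩ T) - C * μ.real S - C * μ.real T + C ^ 2 := by
  rw [centeredIndicator.eq_def μ hT, inner_sub_right, inner_smul_right,
    inner_centeredIndicator_indicator, inner_centeredIndicator_indicator, Set.inter_univ,
    probReal_univ]
  ring

theorem norm_centeredIndicator_le {S : Set X} (hS : MeasurableSet S) (C : ℝ) :
    ‖centeredIndicator μ hS C‖ ≤ 1 + |C| := by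
  have norm_le {T : Set X} (hT : MeasurableSet T) :
      ‖indicatorConstLp 2 hT (measure_ne_top μ T) (1 : ℝ)‖ ≤ 1 := by
    refine norm_indicatorConstLp_le.trans ?_
    rw [norm_one, one_mul]
    exact Real.rpow_le_one measureReal_nonneg measureReal_le_one (by positivity)
  refine (norm_sub_le _ _).trans (add_le_add (norm_le hS) ?_)
  rw [norm_smul, Real.norm_eq_abs]
  exact mul_le_of_le_one_right (abs_nonneg C) (norm_le .univ)

variable {G : Type*} [AddCommGroup G] [AddAction G X] [MeasurableConstVAdd G X]
  [VAddInvariantMeasure G X μ] {ι : Type*} [Fintype ι] {g : ι → ℕ → G} {A : ι → Set X}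
  {p : Ultrafilter (Finset ℕ)}

namespace IsJointlyMixing

theorem tendsto_inner_centeredIndicator (hp : IsIPUltrafilter p)
    (hjoint : IsJointlyMixing μ p fun α j => ipSum (g j) α) (hA : ∀ j, MeasurableSet (A j))
    (β : Finset ℕ) :
    Tendsto (fun α => inner ℝ
        (centeredIndicator μ (measurableSet_iInter_vadd hA fun j => ipSum (g j) (β ∪ α))
          (∏ j, μ.real (A j)))
        (centeredIndicator μ (measurableSet_iInter_vadd hA fun j => ipSum (g j) α)
          (∏ j, μ.real (A j)))) p
      (𝓝 (∏ j, μ.real (A j ∩ (ipSum (g j) β +ᵥ A j)) - (∏ j, μ.real (A j)) ^ 2)) := by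
  set C := ∏ j, μ.real (A j)
  have hβ (j) : MeasurableSet (ipSum (g j) β +ᵥ A j) := (hA j).const_vadd _
  have lim_inter := hjoint _ fun j => (hA j).inter (hβ j)
  have lim_union := hjoint _ hβ
  simp only [measureReal_vadd] at lim_union
  have lim := ((lim_inter.sub (lim_union.const_mul C)).sub ((hjoint A hA).const_mul C)).add_const
    (C ^ 2)
  convert! lim.congr' ?_ using 2
  · ring
  filter_upwards [hp.le_ipAtTop (eventually_before β)] with α hα
  have union_eq (j) : ipSum (g j) (β ∪ α) +ᵥ A j = ipSum (g j) α +ᵥ (ipSum (g j) β +ᵥ A j) := by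
    rw [ipSum_union _ hα, add_comm, add_vadd]
  simp only [inner_centeredIndicator, union_eq, interCorr, Set.vadd_set_inter,
    Set.iInter_inter_distrib, Set.inter_comm]

/-- By the van der Corput trick the indicators of `⋂ j, ipSum (g j) α +ᵥ A j` converge weakly in
`L²(μ)` to the constant `∏ j, μ(A j)`. -/
theorem tendsto_measureReal_inter (hp : IsIPUltrafilter p)
    (hjoint : IsJointlyMixing μ p fun α j => ipSum (g j) α)
    (hsingle : ∀ j, ∀ A B : Set X, MeasurableSet A → MeasurableSet B →
      Tendsto (fun α => μ.real (A ∩ (ipSum (g j) α +ᵥ B))) p (𝓝 (μ.real A * μ.real B)))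
    {A₀ : Set X} (hA₀ : MeasurableSet A₀) (hA : ∀ j, MeasurableSet (A j)) :
    Tendsto (fun α => μ.real (A₀ ∩ ⋂ j, ipSum (g j) α +ᵥ A j)) p
      (𝓝 (μ.real A₀ * ∏ j, μ.real (A j))) := by
  set C := ∏ j, μ.real (A j) with hC
  have lim_prod : Tendsto (fun β => ∏ j, μ.real (A j ∩ (ipSum (g j) β +ᵥ A j)) - C ^ 2) p
      (𝓝 0) := by
    convert! (tendsto_finsetProd Finset.univ fun j _ =>
      hsingle j _ _ (hA j) (hA j)).sub_const (C ^ 2) using 2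
    rw [Finset.prod_mul_distrib, ← hC]
    ring
  have lim_inner := hp.tendsto_inner_zero
    (x := fun α => centeredIndicator μ (measurableSet_iInter_vadd hA fun j => ipSum (g j) α) C)
    (fun α => norm_centeredIndicator_le _ C)
    (fun δ hδ => (lim_prod.eventually_lt_const hδ).mono fun β hβ =>
      ((hjoint.tendsto_inner_centeredIndicator hp hA β).eventually_lt_const hβ).mono
        fun _ h => h.le)
    (indicatorConstLp 2 hA₀ (measure_ne_top μ A₀) 1)
  simp only [inner_centeredIndicator_indicator] at lim_inner
  convert! lim_inner.add_const (C * μ.real A₀) using 2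
  · rw [sub_add_cancel, Set.inter_comm]
  · ring

end IsJointlyMixing

end VanDerCorputStep

section IPStarMixing

variable {G : Type*} [AddCommGroup G] {X : Type*} [MeasurableSpace X] [AddAction G X]
  {μ : Measure X} {p : Ultrafilter (Finset ℕ)}

variable (G) in
/-- The combinatorial form of mild mixing: the sets `{c | |μ(A ∩ T_c B) - μ(A) μ(B)| < ε}` meet
every set of finite sums of a sequence whose finite sums tend to infinity. -/
def IsIPStarMixing (μ : Measure X) : Prop :=
  ∀ A B : Set X, MeasurableSet A → MeasurableSet B → ∀ ε > 0, ∀ g : ℕ → G,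
    IPTendstoInfty (ipSum g) →
      ∃ α : Finset ℕ, α.Nonempty ∧ |μ.real (A ∩ (ipSum g α +ᵥ B)) - μ.real A * μ.real B| < ε

namespace IsIPStarMixing

theorem tendsto (h : IsIPStarMixing G μ) (hp : IsIPUltrafilter p) {g : ℕ → G}
    (hg : IPTendstoInfty (ipSum g)) {A B : Set X} (hA : MeasurableSet A) (hB : MeasurableSet B) :
    Tendsto (fun α => μ.real (A ∩ (ipSum g α +ᵥ B))) p (𝓝 (μ.real A * μ.real B)) := by
  refine hp.tendsto_of_forall_exists (φ := fun c => μ.real (A ∩ (c +ᵥ B))) (fun g hg U hU => ?_) hg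
  obtain ⟨ε, hε, hball⟩ := Metric.mem_nhds_iff.1 hU
  obtain ⟨α, hα, hlt⟩ := h A B hA hB ε hε g hg
  exact ⟨α, hα, hball hlt⟩

variable [IsProbabilityMeasure μ] [MeasurableConstVAdd G X] [VAddInvariantMeasure G X μ]

theorem isJointlyMixing (h : IsIPStarMixing G μ) (hp : IsIPUltrafilter p) {n : ℕ}
    {c : Fin n → ℕ → G} (hc : IsIPDispersed c) :
    IsJointlyMixing μ p fun α j => ipSum (c j) α := by
  induction n with
  | zero => exact fun A _ => by simp [interCorr]
  | succ n ih =>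
    intro A hA
    have hd := hc.isIPTildeGenerator
    rw [isIPTildeGenerator_iff] at hd
    rw [Fin.prod_univ_succ]
    have sub_eq (α : Finset ℕ) (j : Fin n) :
        ipSum (c j.succ) α - ipSum (c 0) α = ipSum (c j.succ - c 0) α := by
      rw [ipSum_sub, Pi.sub_apply]
    simp only [interCorr_eq_multiCorr, multiCorr, sub_eq]
    exact (ih hd.2).tendsto_measureReal_inter hp (fun j A B => h.tendsto hp (hd.1 j)) (hA 0)
      fun j => hA j.succ

end IsIPStarMixing

end IPStarMixing

/-! ### Mild mixing -/

section WeakConvergence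

variable {X : Type*} [MeasurableSpace X] {μ : Measure X} {β : Type*} {F : Filter β}

theorem tendsto_of_tendsto_indicatorConstLp {𝕜 E Y : Type*} [RCLike 𝕜] {σ : 𝕜 →+* 𝕜}
    [RingHomIsometric σ] [NormedAddCommGroup E] [NormedSpace 𝕜 E] [NormedAddCommGroup Y]
    [NormedSpace 𝕜 Y]
    {q : ENNReal} [Fact (1 ≤ q)] (hq : q ≠ ⊤) {φ : β → Lp E q μ →SL[σ] Y} {ψ : Lp E q μ →SL[σ] Y}
    {K : ℝ} (hφ : ∀ b, ‖φ b‖ ≤ K)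
    (h : ∀ (z : E) (S : Set X) (hS : MeasurableSet S) (hμS : μ S ≠ ⊤),
      Tendsto (fun b => φ b (indicatorConstLp q hS hμS z)) F (𝓝 (ψ (indicatorConstLp q hS hμS z))))
    (u : Lp E q μ) : Tendsto (fun b => φ b u) F (𝓝 (ψ u)) := by
  refine Lp.induction hq (fun u => Tendsto (fun b => φ b u) F (𝓝 (ψ u)))
    (fun z S hS hμS => h z S hS hμS.ne) (fun _ _ _ _ _ hf hg => ?_) ?_ u
  · simpa only [map_add] using hf.add hg
  · have lipschitz (b) : LipschitzWith K.toNNReal (φ b) :=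
      (φ b).lipschitz.weaken (NNReal.le_toNNReal_of_coe_le (hφ b))
    exact (LipschitzWith.uniformEquicontinuous _ _ lipschitz).equicontinuous
      |>.isClosed_setOfPred_tendsto ψ.continuous

theorem inner_toLp_toLp {f k : X → ℂ} (hf : MemLp f 2 μ) (hk : MemLp k 2 μ) :
    inner ℂ (hk.toLp k) (hf.toLp f) = ∫ x, f x * (starRingEnd ℂ) (k x) ∂μ := by
  rw [L2.inner_def]
  refine integral_congr_ae ?_
  filter_upwards [hf.coeFn_toLp, hk.coeFn_toLp] with x hfx hkx
  rw [hfx, hkx, RCLike.inner_apply]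

variable {G : Type*} [AddCommGroup G] [AddAction G X] [MeasurableConstVAdd G X]
  [VAddInvariantMeasure G X μ]

variable (μ) in
/-- The Koopman operator `f ↦ f ∘ T_c` of `L²(μ)`. -/
noncomputable def koopman (c : G) : Lp ℂ 2 μ →ₗᵢ[ℂ] Lp ℂ 2 μ :=
  Lp.compMeasurePreservingₗᵢ ℂ (c +ᵥ ·) (measurePreserving_vadd c μ)

theorem inner_koopman_toLp (c : G) {f k : X → ℂ} (hf : MemLp f 2 μ) (hk : MemLp k 2 μ) :
    inner ℂ (hk.toLp k) (koopman μ c (hf.toLp f)) =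
      ∫ x, f (c +ᵥ x) * (starRingEnd ℂ) (k x) ∂μ :=
  inner_toLp_toLp (hf.comp_measurePreserving (measurePreserving_vadd c μ)) hk

variable [IsProbabilityMeasure μ]

theorem inner_koopman_indicatorConstLp (c : G) {A B : Set X} (hA : MeasurableSet A)
    (hB : MeasurableSet B) (z w : ℂ) :
    inner ℂ (indicatorConstLp 2 hA (measure_ne_top μ A) z)
        (koopman μ c (indicatorConstLp 2 hB (measure_ne_top μ B) w)) =
      μ.real (A ∩ (c +ᵥ ·) ⁻¹' B) • inner ℂ z w := by
  have koopman_eq : koopman μ c (indicatorConstLp 2 hB (measure_ne_top μ B) w) =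
      indicatorConstLp 2 (measurable_const_vadd c hB) (measure_ne_top μ _) w :=
    Lp.indicatorConstLp_compMeasurePreserving hB _ w (measurePreserving_vadd c μ)
  rw [koopman_eq, L2.inner_indicatorConstLp_indicatorConstLp]

theorem inner_const_mul_inner_const {A B : Set X} (hA : MeasurableSet A) (hB : MeasurableSet B)
    (z w : ℂ) :
    inner ℂ (Lp.const 2 μ 1) (indicatorConstLp 2 hB (measure_ne_top μ B) w) *
        inner ℂ (indicatorConstLp 2 hA (measure_ne_top μ A) z) (Lp.const 2 μ 1) =
      (μ.real A * μ.real B) • inner ℂ z w := by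
  rw [← indicatorConstLp_univ, L2.inner_indicatorConstLp_indicatorConstLp,
    L2.inner_indicatorConstLp_indicatorConstLp, Set.inter_univ, Set.univ_inter]
  simp only [RCLike.inner_apply, map_one, one_mul, mul_one, Complex.real_smul, Complex.ofReal_mul]
  ring

theorem tendsto_inner_indicatorConstLp_koopman {c : β → G}
    (h : ∀ A B : Set X, MeasurableSet A → MeasurableSet B →
      Tendsto (fun b => μ.real (A ∩ (c b +ᵥ ·) ⁻¹' B)) F (𝓝 (μ.real A * μ.real B)))
    (z : ℂ) {A : Set X} (hA : MeasurableSet A) (u : Lp ℂ 2 μ) :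
    let v := indicatorConstLp 2 hA (measure_ne_top μ A) z
    Tendsto (fun b => inner ℂ v (koopman μ (c b) u)) F
      (𝓝 (inner ℂ (Lp.const 2 μ 1) u * inner ℂ v (Lp.const 2 μ 1))) := by
  intro v
  rw [mul_comm]
  refine tendsto_of_tendsto_indicatorConstLp ENNReal.ofNat_ne_top
    (φ := fun b => innerSL ℂ v ∘L (koopman μ (c b)).toContinuousLinearMap)
    (ψ := inner ℂ v (Lp.const 2 μ 1) • innerSL ℂ (Lp.const 2 μ 1))
    (fun b => (ContinuousLinearMap.opNorm_comp_le _ _).trans <|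
      mul_le_of_le_one_right (norm_nonneg _) (koopman μ (c b)).norm_toContinuousLinearMap_le)
    (fun w B hB _ => ?_) u
  convert! (h A B hA hB).smul_const (inner ℂ z w) using 2
  · exact inner_koopman_indicatorConstLp _ hA hB z w
  · exact (mul_comm _ _).trans (inner_const_mul_inner_const hA hB z w)

theorem tendsto_inner_koopman {c : β → G}
    (h : ∀ A B : Set X, MeasurableSet A → MeasurableSet B →
      Tendsto (fun b => μ.real (A ∩ (c b +ᵥ ·) ⁻¹' B)) F (𝓝 (μ.real A * μ.real B)))
    (v u : Lp ℂ 2 μ) :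
    Tendsto (fun b => inner ℂ v (koopman μ (c b) u)) F
      (𝓝 (inner ℂ (Lp.const 2 μ 1) u * inner ℂ v (Lp.const 2 μ 1))) := by
  let Φ := (innerSL ℂ (E := Lp ℂ 2 μ)).flip
  exact tendsto_of_tendsto_indicatorConstLp ENNReal.ofNat_ne_top
    (φ := fun b => Φ (koopman μ (c b) u)) (ψ := inner ℂ (Lp.const 2 μ 1) u • Φ (Lp.const 2 μ 1))
    (fun b => (Φ.le_opNorm _).trans_eq (by rw [(koopman μ _).norm_map]))
    (fun z A hA _ => tendsto_inner_indicatorConstLp_koopman h z hA u) v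

theorem tendsto_integral_mul_conj {c : β → G}
    (h : ∀ A B : Set X, MeasurableSet A → MeasurableSet B →
      Tendsto (fun b => μ.real (A ∩ (c b +ᵥ ·) ⁻¹' B)) F (𝓝 (μ.real A * μ.real B)))
    {f k : X → ℂ} (hf : MemLp f 2 μ) (hk : MemLp k 2 μ) :
    Tendsto (fun b => ∫ x, f (c b +ᵥ x) * (starRingEnd ℂ) (k x) ∂μ) F
      (𝓝 (∫ x, (∫ y, f y ∂μ) * (starRingEnd ℂ) (k x) ∂μ)) := by
  have lim := tendsto_inner_koopman h (hk.toLp k) (hf.toLp f)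
  simpa only [inner_koopman_toLp, ← MemLp.toLp_const, inner_toLp_toLp, map_one, mul_one, one_mul,
    ← integral_const_mul] using lim

end WeakConvergence

/-! ### The equivalences -/

section Sequences

variable {G : Type*} [AddCommGroup G] {m n : ℕ}

theorem sigmaSum_const (x : ℕ → G) (α : MSubsets m) :
    sigmaSum (fun k (_ : Fin m) => x k) α = ipSum x α.1 := by
  rw [ipSum, ← Finset.map_orderEmbOfFin_univ α.1 α.2, Finset.sum_map]
  rfl

theorem IPTendstoInfty.tendsto_atTop {x : ℕ → G} (hx : IPTendstoInfty (ipSum x)) :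
    Tendsto x atTop cofinite := by
  simpa only [Function.comp_def, ipSum, Finset.sum_singleton] using
    (ipTendstoInfty_iff.1 hx).comp tendsto_singleton_ipAtTop

theorem MSubsets.nonempty (hm : 1 ≤ m) (α : MSubsets m) : α.1.Nonempty :=
  Finset.card_pos.1 (hm.trans_eq α.2.symm)

theorem MSubsets.exists_before (m : ℕ) (β : Finset ℕ) : ∃ α : MSubsets m, Before β α.1 :=
  ⟨⟨Finset.Ico (β.sup id + 1) (β.sup id + 1 + m), by simp⟩, fun _ hb _ ha =>
    (Finset.le_sup (f := id) hb).trans_lt (Finset.mem_Ico.1 ha).1⟩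

theorem rLim_of_tendsto {Y : Type*} [PseudoMetricSpace Y] {x : Finset ℕ → Y} {y : Y}
    (hm : 1 ≤ m) (hx : Tendsto x ipAtTop (𝓝 y)) :
    RLim Set.univ (fun α : MSubsets m => x α.1) y := by
  intro ε hε
  obtain ⟨k, hk⟩ := eventually_ipAtTop_iff.1 (Metric.tendsto_nhds.1 hx ε hε)
  obtain ⟨β, hβ⟩ := MSubsets.exists_before m {k}
  obtain ⟨b, hb⟩ := β.nonempty hm
  exact ⟨β, fun α _ hα => hk α.1 (α.nonempty hm) fun i hi =>
    (hβ k (Finset.mem_singleton_self k) b hb).le.trans (hα b hb i hi).le⟩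

end Sequences

variable {G : Type*} [AddCommGroup G] {X : Type*} [MeasurableSpace X] [AddAction G X]
  {μ : Measure X} {m n : ℕ}

theorem isIPStarMixing_of_forall_isIPTilde
    (h : ∀ E : Set (Fin (n + 1) → G), IsIPTilde E → ∀ A B : Set X, MeasurableSet A →
      MeasurableSet B → ∀ ε > 0, ∃ c ∈ E, |μ.real (A ∩ (c 0 +ᵥ B)) - μ.real A * μ.real B| < ε) :
    IsIPStarMixing G μ := by
  intro A B hA hB ε hε g hg
  obtain ⟨x, hx, hsum⟩ := exists_isIPTildeGenerator hg n
  obtain ⟨_, ⟨α, hα, rfl⟩, hlt⟩ := h _ ⟨x, hx, rfl⟩ A B hA hB ε hε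
  obtain ⟨β, hβ, hβα⟩ := hsum α hα
  exact ⟨β, hβ, by rwa [← hβα]⟩

theorem isIPStarMixing_of_isIPTildeStar [IsProbabilityMeasure μ]
    (h : ∀ A : Fin (n + 2) → Set X, (∀ j, MeasurableSet (A j)) → ∀ ε : ℝ, 0 < ε →
      IsIPTildeStar (returnSet G μ ε A)) : IsIPStarMixing G μ := by
  refine isIPStarMixing_of_forall_isIPTilde (n := n) fun E hE A B hA hB ε hε => ?_
  let S : Fin (n + 2) → Set X := Matrix.vecCons A (Matrix.vecCons B fun _ => Set.univ)
  have hS : ∀ j, MeasurableSet (S j) := by simp [S, Fin.forall_fin_succ, hA, hB]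
  obtain ⟨c, hc, hcE⟩ := h S hS ε hε E hE
  have multiCorr_eq : multiCorr μ S c = μ.real (A ∩ (c 0 +ᵥ B)) := by
    rw [multiCorr]
    congr 1
    ext x
    simp [S, Fin.forall_fin_succ]
  have prod_eq : ∏ j, μ.real (S j) = μ.real A * μ.real B := by simp [S, Fin.prod_univ_succ]
  refine ⟨c, hcE, ?_⟩
  rwa [returnSet, Set.mem_ofPred_eq, multiCorr_eq, prod_eq] at hc

theorem isIPTildeStar_returnSet_of_rLim {A : Fin (n + 1) → Set X}
    (h : ∀ E : Set (Fin n → G), IsIPTilde E → ∃ m, ∃ g : Fin n → ℕ → Fin m → G,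
      (∀ α : MSubsets m, (fun j => sigmaSum (g j) α) ∈ E) ∧
      RLim Set.univ (fun α : MSubsets m => multiCorr μ A fun j => sigmaSum (g j) α)
        (∏ j, μ.real (A j)))
    {ε : ℝ} (hε : 0 < ε) : IsIPTildeStar (returnSet G μ ε A) := by
  intro E hE
  obtain ⟨m, g, hgE, hlim⟩ := h E hE
  obtain ⟨α₀, hα₀⟩ := hlim ε hε
  obtain ⟨α, hα⟩ := MSubsets.exists_before m α₀.1
  exact ⟨_, hα₀ α (Set.subset_univ _) hα, hgE α⟩

theorem isIPTildeStar_returnSet_of_ipLim {A : Fin (n + 1) → Set X}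
    (h : ∀ g : Fin n → ℕ → G, IsIPTildeGenerator g → ∃ R : Set (Finset ℕ), IsIPRing R ∧
      IPLim R (fun α => multiCorr μ A fun j => ipSum (g j) α) (∏ j, μ.real (A j)))
    {ε : ℝ} (hε : 0 < ε) : IsIPTildeStar (returnSet G μ ε A) := by
  rintro _ ⟨g, hg, rfl⟩
  obtain ⟨R, hR, hlim⟩ := h g hg
  obtain ⟨a, ha, rfl⟩ := hR.exists_isRingBase
  obtain ⟨α, hα, hlt⟩ := (eventually_nonempty.and
    (Metric.tendsto_nhds.1 (ha.ipLim_iff.1 hlim) ε hε)).exists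
  exact ⟨_, hlt, α.biUnion a, hα.biUnion fun k _ => ha.nonempty k, rfl⟩

variable [VAddInvariantMeasure G X μ]

theorem isIPStarMixing_of_hasMixingProperty
    (h : ∀ E : Set (Fin (n + 1) → G), IsIPTilde E → ∃ g : Fin (n + 1) → ℕ → Fin 1 → G,
      (∀ α : MSubsets 1, (fun j => sigmaSum (g j) α) ∈ E) ∧
      HasMixingProperty (fun k (x : X) => g 0 k 0 +ᵥ x) μ) : IsIPStarMixing G μ := by
  refine isIPStarMixing_of_forall_isIPTilde (n := n) fun E hE A B hA hB ε hε => ?_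
  obtain ⟨g, hgE, hmix⟩ := h E hE
  obtain ⟨k, hk⟩ := (Metric.tendsto_nhds.1 (hmix B A hB hA) ε hε).exists
  have sigmaSum_eq : sigmaSum (g 0) ⟨{k}, Finset.card_singleton k⟩ = g 0 k 0 := by
    simp [sigmaSum]
  refine ⟨_, hgE ⟨{k}, Finset.card_singleton k⟩, ?_⟩
  rw [measureReal_inter_preimage_vadd, mul_comm] at hk
  rwa [sigmaSum_eq]

variable [MeasurableConstVAdd G X] [IsProbabilityMeasure μ]

theorem integral_indicator_mul_conj_indicator (c : G) {A B : Set X} (hA : MeasurableSet A)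
    (hB : MeasurableSet B) :
    ∫ x, A.indicator (fun _ => (1 : ℂ)) (c +ᵥ x) *
        (starRingEnd ℂ) (B.indicator (fun _ => (1 : ℂ)) x) ∂μ = μ.real (A ∩ (c +ᵥ B)) := by
  have memLp {S : Set X} (hS : MeasurableSet S) : MemLp (S.indicator fun _ => (1 : ℂ)) 2 μ :=
    memLp_indicator_const 2 hS 1 (.inr (measure_ne_top μ S))
  rw [← inner_koopman_toLp c (memLp hA) (memLp hB)]
  refine (inner_koopman_indicatorConstLp c hB hA 1 1).trans ?_
  rw [measureReal_inter_preimage_vadd]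
  simp

theorem IsMildlyMixing.isIPStarMixing (h : IsMildlyMixing G μ) : IsIPStarMixing G μ := by
  intro A B hA hB ε hε g hg
  obtain ⟨R, hR, hlim⟩ := h g hg
  obtain ⟨a, ha, rfl⟩ := hR.exists_isRingBase
  have lim := ha.ipLim_iff.1 <| hlim
    _ (memLp_indicator_const 2 hA 1 (.inr (measure_ne_top μ A)))
    _ (memLp_indicator_const 2 hB 1 (.inr (measure_ne_top μ B)))
  have limit_eq : ∫ x, (∫ y, A.indicator (fun _ => (1 : ℂ)) y ∂μ) *
      (starRingEnd ℂ) (B.indicator (fun _ => (1 : ℂ)) x) ∂μ = (μ.real A * μ.real B : ℝ) := by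
    rw [integral_const_mul, integral_conj, integral_indicator_const _ hA,
      integral_indicator_const _ hB]
    simp
  simp only [integral_indicator_mul_conj_indicator _ hA hB, limit_eq] at lim
  obtain ⟨α, hα, hlt⟩ := (eventually_nonempty.and
    (Metric.tendsto_nhds.1 (tendsto_ofReal_iff.1 lim) ε hε)).exists
  exact ⟨_, hα.biUnion fun k _ => ha.nonempty k, hlt⟩

namespace IsIPStarMixing

variable [IsSeparable μ]

theorem exists_isRingBase (h : IsIPStarMixing G μ) {c : Fin n → ℕ → G} (hc : IsIPDispersed c) :
    ∃ a, IsRingBase a ∧ IsJointlyMixing μ ipAtTop fun α j => ipSum (c j) (α.biUnion a) := by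
  obtain ⟨p, hp⟩ := exists_isIPUltrafilter
  obtain ⟨𝒟, h𝒟count, h𝒟⟩ := exists_countable_measureDense μ
  have := h𝒟count.to_subtype
  have lim : Tendsto
      (fun α (A : Fin n → 𝒟) => interCorr μ (fun j => (A j : Set X)) fun j => ipSum (c j) α) p
      (𝓝 fun A => ∏ j, μ.real (A j)) :=
    tendsto_pi_nhds.2 fun A => h.isJointlyMixing hp hc _ fun j => h𝒟.measurable _ (A j).2
  obtain ⟨a, ha, hlim⟩ := hp.exists_isRingBase_tendsto lim
  exact ⟨a, ha, isJointlyMixing_of_measureDense h𝒟 (tendsto_pi_nhds.1 hlim)⟩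

theorem isMildlyMixing (h : IsIPStarMixing G μ) : IsMildlyMixing G μ := by
  intro g hg
  have hgen : IsIPTildeGenerator fun _ : Fin 1 => g :=
    ⟨fun _ => hg, fun i j hij => absurd (Subsingleton.elim i j) hij⟩
  obtain ⟨a, ha, hjoint⟩ := h.exists_isRingBase (isIPDispersed_vecCons_zero.2 hgen)
  have lim (A B : Set X) (hA : MeasurableSet A) (hB : MeasurableSet B) :
      Tendsto (fun α : Finset ℕ => μ.real (A ∩ (ipSum g (α.biUnion a) +ᵥ ·) ⁻¹' B)) ipAtTop
        (𝓝 (μ.real A * μ.real B)) := by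
    simpa only [Matrix.cons_val_zero, Matrix.cons_val_succ, ipSum_zero, Pi.zero_apply, sub_zero]
      using hjoint.tendsto_inter_preimage (Fin.succ_ne_zero 0).symm hA hB
  exact ⟨ringOf a, ha.isIPRing, fun f hf k hk => ha.ipLim_iff.2
    (tendsto_integral_mul_conj lim hf hk)⟩

theorem exists_isIPRing (h : IsIPStarMixing G μ) {g : Fin n → ℕ → G} (hg : IsIPTildeGenerator g) :
    ∃ R : Set (Finset ℕ), IsIPRing R ∧
      ∀ A : Fin (n + 1) → Set X, (∀ j, MeasurableSet (A j)) →
        IPLim R (fun α => multiCorr μ A (fun j => ipSum (g j) α)) (∏ j, μ.real (A j)) := by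
  obtain ⟨a, ha, hjoint⟩ := h.exists_isRingBase (isIPDispersed_vecCons_zero.2 hg)
  refine ⟨ringOf a, ha.isIPRing, fun A hA => ha.ipLim_iff.2 ?_⟩
  simpa only [multiCorr_ipSum] using hjoint A hA

theorem exists_isIPTildeGenerator (h : IsIPStarMixing G μ) {E : Set (Fin n → G)}
    (hE : IsIPTilde E) :
    ∃ x : Fin n → ℕ → G, IsIPTildeGenerator x ∧
      (∀ α : Finset ℕ, α.Nonempty → (fun j => ipSum (x j) α) ∈ E) ∧
      IsJointlyMixing μ ipAtTop fun α j => ipSum (Matrix.vecCons 0 x j) α := by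
  obtain ⟨g, hg, rfl⟩ := hE
  obtain ⟨a, ha, hjoint⟩ := h.exists_isRingBase (isIPDispersed_vecCons_zero.2 hg)
  have sum_eq (α : Finset ℕ) (j : Fin n) := ha.ipSum_biUnion (g j) α
  refine ⟨fun j k => ipSum (g j) (a k), ?_, fun α hα => ?_, ?_⟩
  · rw [isIPTildeGenerator_iff] at hg ⊢
    refine ⟨fun j => ha.ipTendstoInfty (hg.1 j), fun i j hij => ?_⟩
    convert! ha.ipTendstoInfty (hg.2 i j hij) using 2
    ext k
    simp [ipSum_sub]
  · exact ⟨α.biUnion a, hα.biUnion fun k _ => ha.nonempty k, funext fun j => (sum_eq α j).symm⟩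
  · convert! hjoint using 3 with α j
    exact Fin.cases (by simp [ipSum_zero]) (fun j => by simp [sum_eq]) j

theorem exists_mixing_sequences (h : IsIPStarMixing G μ) {E : Set (Fin n → G)} (hE : IsIPTilde E)
    (hm : 1 ≤ m) :
    ∃ g : Fin n → ℕ → Fin m → G,
      (∀ j, NonDegenerated (g j)) ∧
      (∀ i j, i ≠ j → EssentiallyDistinct (g j) (g i)) ∧
      (∀ α : MSubsets m, (fun j => sigmaSum (g j) α) ∈ E) ∧
      (∀ (t : Fin m) (j : Fin n), HasMixingProperty (fun k (x : X) => g j k t +ᵥ x) μ) ∧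
      (∀ (t : Fin m) (i j : Fin n), i ≠ j →
        HasMixingProperty (fun k (x : X) => (g j k t - g i k t) +ᵥ x) μ) := by
  obtain ⟨x, hx, hxE, hjoint⟩ := h.exists_isIPTildeGenerator hE
  rw [isIPTildeGenerator_iff] at hx
  have hmix {i j : Fin (n + 1)} (hij : i ≠ j) : HasMixingProperty
      (fun k (y : X) => (Matrix.vecCons 0 x j k - Matrix.vecCons 0 x i k) +ᵥ y) μ :=
    fun A B hA hB => by
      simpa only [Function.comp_def, ipSum, Finset.sum_singleton] using
        (hjoint.tendsto_inter_preimage hij hA hB).comp tendsto_singleton_ipAtTop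
  refine ⟨fun j k _ => x j k, fun j _ => (hx.1 j).tendsto_atTop,
    fun i j hij _ => (hx.2 i j hij).tendsto_atTop, fun α => ?_, fun _ j => ?_, fun _ i j hij => ?_⟩
  · simpa only [sigmaSum_const] using hxE α (α.nonempty hm)
  · simpa using hmix (Fin.succ_ne_zero j).symm
  · simpa using hmix ((Fin.succ_injective n).ne hij)

theorem exists_rLim_sequences (h : IsIPStarMixing G μ) {E : Set (Fin n → G)} (hE : IsIPTilde E)
    (hm : 1 ≤ m) :
    ∃ g : Fin n → ℕ → Fin m → G,
      (∀ j, NonDegenerated (g j)) ∧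
      (∀ i j, i ≠ j → EssentiallyDistinct (g j) (g i)) ∧
      (∀ α : MSubsets m, (fun j => sigmaSum (g j) α) ∈ E) ∧
      ∀ A : Fin (n + 1) → Set X, (∀ j, MeasurableSet (A j)) →
        RLim Set.univ (fun α : MSubsets m => multiCorr μ A (fun j => sigmaSum (g j) α))
          (∏ j, μ.real (A j)) := by
  obtain ⟨x, hx, hxE, hjoint⟩ := h.exists_isIPTildeGenerator hE
  rw [isIPTildeGenerator_iff] at hx
  refine ⟨fun j k _ => x j k, fun j _ => (hx.1 j).tendsto_atTop,
    fun i j hij _ => (hx.2 i j hij).tendsto_atTop, fun α => ?_, fun A hA => ?_⟩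
  · simpa only [sigmaSum_const] using hxE α (α.nonempty hm)
  · simpa only [sigmaSum_const, multiCorr_ipSum] using rLim_of_tendsto hm (hjoint A hA)

end IsIPStarMixing

end MildMixing

open MildMixing in
theorem theorem6p1_general
    {G : Type*} [AddCommGroup G]
    {X : Type*} [MeasurableSpace X] [AddAction G X] [MeasurableConstVAdd G X]
    (μ : Measure X) [IsProbabilityMeasure μ] [MeasureTheory.IsSeparable μ]
    [VAddInvariantMeasure G X μ]
    (ℓ : ℕ) (hℓ : 1 ≤ ℓ) :
    List.TFAE [
      IsMildlyMixing G μ,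
      ∀ E : Set (Fin ℓ → G), IsIPTilde E → ∀ m : ℕ, 1 ≤ m →
        ∃ g : Fin ℓ → ℕ → Fin m → G,
          (∀ j, NonDegenerated (g j)) ∧
          (∀ i j, i ≠ j → EssentiallyDistinct (g j) (g i)) ∧
          (∀ α : MSubsets m, (fun j => sigmaSum (g j) α) ∈ E) ∧
          (∀ (t : Fin m) (j : Fin ℓ), HasMixingProperty (fun k (x : X) => g j k t +ᵥ x) μ) ∧
          (∀ (t : Fin m) (i j : Fin ℓ), i ≠ j →
            HasMixingProperty (fun k (x : X) => (g j k t - g i k t) +ᵥ x) μ),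
      ∀ E : Set (Fin ℓ → G), IsIPTilde E →
        ∃ m : ℕ, 1 ≤ m ∧ ∃ g : Fin ℓ → ℕ → Fin m → G,
          (∀ j, NonDegenerated (g j)) ∧
          (∀ i j, i ≠ j → EssentiallyDistinct (g j) (g i)) ∧
          (∀ α : MSubsets m, (fun j => sigmaSum (g j) α) ∈ E) ∧
          ∀ A : Fin (ℓ + 1) → Set X, (∀ j, MeasurableSet (A j)) →
            RLim Set.univ (fun α : MSubsets m => multiCorr μ A (fun j => sigmaSum (g j) α))
              (∏ j, μ.real (A j)),
      ∀ g : Fin ℓ → ℕ → G, IsIPTildeGenerator g →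
        ∃ R : Set (Finset ℕ), IsIPRing R ∧
          ∀ A : Fin (ℓ + 1) → Set X, (∀ j, MeasurableSet (A j)) →
            IPLim R (fun α => multiCorr μ A (fun j => ipSum (g j) α)) (∏ j, μ.real (A j)),
      ∀ A : Fin (ℓ + 1) → Set X, (∀ j, MeasurableSet (A j)) → ∀ ε : ℝ, 0 < ε →
        IsIPTildeStar (returnSet G μ ε A)] := by
  obtain ⟨n, rfl⟩ := Nat.exists_eq_succ_of_ne_zero (Nat.one_le_iff_ne_zero.1 hℓ)
  tfae_have 1 → 2 := fun h E hE m hm => h.isIPStarMixing.exists_mixing_sequences hE hm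
  tfae_have 1 → 3 := fun h E hE => ⟨1, le_rfl, h.isIPStarMixing.exists_rLim_sequences hE le_rfl⟩
  tfae_have 1 → 4 := fun h g hg => h.isIPStarMixing.exists_isIPRing hg
  tfae_have 2 → 1 := by
    refine fun h => (isIPStarMixing_of_hasMixingProperty (n := n) fun E hE => ?_).isMildlyMixing
    obtain ⟨g, -, -, hgE, hmix, -⟩ := h E hE 1 le_rfl
    exact ⟨g, hgE, hmix 0 0⟩
  tfae_have 3 → 5 := by
    refine fun h A hA ε hε => isIPTildeStar_returnSet_of_rLim (fun E hE => ?_) hε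
    obtain ⟨m, -, g, -, -, hgE, hlim⟩ := h E hE
    exact ⟨m, g, hgE, hlim A hA⟩
  tfae_have 4 → 5 := by
    refine fun h A hA ε hε => isIPTildeStar_returnSet_of_ipLim (fun g hg => ?_) hε
    obtain ⟨R, hR, hlim⟩ := h g hg
    exact ⟨R, hR, hlim A hA⟩
  tfae_have 5 → 1 := fun h => (isIPStarMixing_of_isIPTildeStar h).isMildlyMixing
  tfae_finish

open MildMixing in
theorem theorem6p1
    {G : Type*} [AddCommGroup G] [Countable G]
    {X : Type*} [MeasurableSpace X] [AddAction G X] [MeasurableConstVAdd G X]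
    (μ : Measure X) [IsProbabilityMeasure μ] [MeasureTheory.IsSeparable μ]
    [VAddInvariantMeasure G X μ]
    (ℓ : ℕ) (hℓ : 1 ≤ ℓ) :
    List.TFAE [
      -- (i)
      IsMildlyMixing G μ,
      -- (ii)
      ∀ E : Set (Fin ℓ → G), IsIPTilde E → ∀ m : ℕ, 1 ≤ m →
        ∃ g : Fin ℓ → ℕ → Fin m → G,
          (∀ j, NonDegenerated (g j)) ∧
          (∀ i j, i ≠ j → EssentiallyDistinct (g j) (g i)) ∧
          (∀ α : MSubsets m, (fun j => sigmaSum (g j) α) ∈ E) ∧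
          (∀ (t : Fin m) (j : Fin ℓ), HasMixingProperty (fun k (x : X) => g j k t +ᵥ x) μ) ∧
          (∀ (t : Fin m) (i j : Fin ℓ), i ≠ j →
            HasMixingProperty (fun k (x : X) => (g j k t - g i k t) +ᵥ x) μ),
      -- (iii)
      ∀ E : Set (Fin ℓ → G), IsIPTilde E →
        ∃ m : ℕ, 1 ≤ m ∧ ∃ g : Fin ℓ → ℕ → Fin m → G,
          (∀ j, NonDegenerated (g j)) ∧
          (∀ i j, i ≠ j → EssentiallyDistinct (g j) (g i)) ∧
          (∀ α : MSubsets m, (fun j => sigmaSum (g j) α) ∈ E) ∧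
          ∀ A : Fin (ℓ + 1) → Set X, (∀ j, MeasurableSet (A j)) →
            RLim Set.univ (fun α : MSubsets m => multiCorr μ A (fun j => sigmaSum (g j) α))
              (∏ j, μ.real (A j)),
      -- (iv)
      ∀ g : Fin ℓ → ℕ → G, IsIPTildeGenerator g →
        ∃ R : Set (Finset ℕ), IsIPRing R ∧
          ∀ A : Fin (ℓ + 1) → Set X, (∀ j, MeasurableSet (A j)) →
            IPLim R (fun α => multiCorr μ A (fun j => ipSum (g j) α)) (∏ j, μ.real (A j)),
      -- (v)
      ∀ A : Fin (ℓ + 1) → Set X, (∀ j, MeasurableSet (A j)) → ∀ ε : ℝ, 0 < ε →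
        IsIPTildeStar (returnSet G μ ε A)] :=
  theorem6p1_general μ ℓ hℓ
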